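/- Let $\Omega=(0,1)$ or $\Omega=(0,\infty)$ with Lebesgue measure $m$, and let $L_0(\Omega)$ be the space of (classes of) measurable real functions on $\Omega$. Let $X$ be a rearrangement invariant Banach space on $\Omega$, that is: $X$ is a Banach space which is a linear subspace of $L_0(\Omega)$ and contains an a.e. positive function; if $|f|\le|g|$ a.e. and $g\in X$, then $f\in X$ and $\|f\|_X\le\|g\|_X$; and if $f\in X$ and $m\{|f|>\lambda\}=m\{|g|>\lambda\}$ for all $\lambda\ge0$, then $g\in X$ and $\|g\|_X=\|f\|_X$. Suppose that $X$ has the Fatou property (if $f_n\in X$, $0\le f_n\uparrow f\in L_0(\Omega)$ and $\sup_n\|f_n\|_X<\infty$, then $f\in X$ and $\|f_n\|_X\uparrow\|f\|_X$), and that the ideal $$X_a=\{f\in X:\ \|u_n\|_X\to0 \text{ for every sequence } (u_n)\subset X \text{ with } 0\le u_n\le|f| \text{ and } u_n\downarrow0\}$$ is trivial, $X_a=\{0\}$. Put $C(f)(x)=\frac1x\int_0^x|f(t)|\,dt$ for $x \in \Omega$, and let $CX=\{f\in L_0(\Omega): C(f)\in X\}$ with the norm $\|f\|_{CX}=\|C(f)\|_X$.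 Suppose that there is a function $f\in CX$, $f>0$ (i.e. $f\ge0$ a.e. and $f\ne0$), such that (i) $C(f)(0^+)=\lim_{x\to0^+}C(f)(x)=1$, (ii) $\|f\|_{CX}\cdot\|\mathrm{id}\colon X\to L_\infty\|=1$, where $\|\mathrm{id}\colon X\to L_\infty\|=\sup\{\|g\|_{L_\infty}:\|g\|_X\le1\}$ (so that, if the norm of $X$ is normalized by $\|\mathrm{id}\colon X\to L_\infty\|=1$, the condition reads $\|f\|_{CX}=\|\mathrm{id}\colon X\to L_\infty\|=1$). Then $CX$ contains a lattice isometric copy of $\ell_\infty$: there is a linear map $T\colon\ell_\infty\to CX$ with $\|Tx\|_{CX}=\|x\|_\infty$ and $T(x\vee y)=Tx\vee Ty$ for all $x,y\in\ell_\infty$. -/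

import Mathlib

open MeasureTheory Set Filter Topology
open scoped ENNReal

/-- A Banach ideal space on `(α, μ)`: a Banach space which is a linear subspace of `L₀(μ)`, has the
ideal property, and contains a weak unit (a function that is positive almost everywhere). -/
structure BanachIdealSpace {α : Type*} [MeasurableSpace α] (μ : Measure α) where
  /-- the underlying linear subspace of `L₀(μ)` -/
  carrier : Submodule ℝ (α →ₘ[μ] ℝ)
  /-- the norm -/
  nrm : Seminorm ℝ carrier
  eq_zero_of_nrm : ∀ f : carrier, nrm f = 0 → f = 0
  complete : ∀ u : ℕ → carrier,
    (∀ ε : ℝ, 0 < ε → ∃ N : ℕ, ∀ m ≥ N, ∀ n ≥ N, nrm (u m - u n) < ε) →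
    ∃ g : carrier, Tendsto (fun n => nrm (u n - g)) atTop (𝓝 0)
  ideal : ∀ (f : α →ₘ[μ] ℝ) (g : carrier), |f| ≤ |(g : α →ₘ[μ] ℝ)| →
    ∃ hf : f ∈ carrier, nrm ⟨f, hf⟩ ≤ nrm g
  weak_unit : ∃ g ∈ carrier, ∀ᵐ t ∂μ, 0 < g t

namespace BanachIdealSpace

variable {α : Type*} [MeasurableSpace α] {μ : Measure α}

/-- Membership and norm in `X` depend only on the distribution function
`lam ↦ μ {t | lam < |f t|}`, `lam ≥ 0`. -/
def IsRearrangementInvariant (X : BanachIdealSpace μ) : Prop :=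
  ∀ (f : X.carrier) (g : α →ₘ[μ] ℝ),
    (∀ lam : ℝ, 0 ≤ lam →
      μ {t | lam < |(f : α →ₘ[μ] ℝ) t|} = μ {t | lam < |g t|}) →
    ∃ hg : g ∈ X.carrier, X.nrm ⟨g, hg⟩ = X.nrm f

/-- The Fatou property: if `0 ≤ fₙ ↑ f ∈ L₀` with `fₙ ∈ X` and `sup ‖fₙ‖ < ∞`, then `f ∈ X` and
`‖fₙ‖ ↑ ‖f‖`. -/
def HasFatouProperty (X : BanachIdealSpace μ) : Prop :=
  ∀ (u : ℕ → X.carrier) (f : α →ₘ[μ] ℝ),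
    (∀ n, 0 ≤ (u n : α →ₘ[μ] ℝ)) →
    Monotone u →
    (∀ᵐ t ∂μ, Tendsto (fun n => (u n : α →ₘ[μ] ℝ) t) atTop (𝓝 (f t))) →
    BddAbove (range fun n => X.nrm (u n)) →
    ∃ hf : f ∈ X.carrier, Tendsto (fun n => X.nrm (u n)) atTop (𝓝 (X.nrm ⟨f, hf⟩))

/-- `X_a`, the set of all order continuous elements of `X`: those `f` for which every sequence
`|f| ≥ u₀ ≥ u₁ ≥ … ≥ 0` in `X` with infimum `0` converges to `0` in norm. -/
def orderContinuousPart (X : BanachIdealSpace μ) : Set X.carrier :=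
  {f | ∀ u : ℕ → X.carrier,
    (∀ n, 0 ≤ (u n : α →ₘ[μ] ℝ) ∧ (u n : α →ₘ[μ] ℝ) ≤ |(f : α →ₘ[μ] ℝ)|) →
    Antitone u →
    IsGLB (range u) 0 →
    Tendsto (fun n => X.nrm (u n)) atTop (𝓝 0)}

/-- The norm of `id : X → L_∞`, i.e. the supremum of `‖g‖_∞` over the unit ball of `X`; it is `∞`
if `X` does not embed into `L_∞`. -/
noncomputable def normIdLinfty (X : BanachIdealSpace μ) : ℝ≥0∞ :=
  ⨆ (g : X.carrier) (_ : X.nrm g ≤ 1), eLpNorm (g : α →ₘ[μ] ℝ) ∞ μ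

end BanachIdealSpace

/-- The averages `C(|f|)(x) = (1/x) ∫₀ˣ |f(t)| dt` for `x > 0`, with values in `[0, ∞]`. -/
noncomputable def cesaroAvg {μ : Measure ℝ} (f : ℝ →ₘ[μ] ℝ) (x : ℝ) : ℝ≥0∞ :=
  (∫⁻ t in Ioo 0 x, ‖f t‖ₑ ∂μ) / ENNReal.ofReal x

theorem measurable_cesaroAvg {μ : Measure ℝ} (f : ℝ →ₘ[μ] ℝ) : Measurable (cesaroAvg f) := by
  refine Measurable.div (Monotone.measurable ?_) ENNReal.measurable_ofReal
  intro x y hxy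
  exact lintegral_mono_set (Ioo_subset_Ioo_right hxy)

/-- The class of `C(|f|)` in `L₀`; meaningful when the averages are finite almost everywhere. -/
noncomputable def cesaro {μ : Measure ℝ} (f : ℝ →ₘ[μ] ℝ) : ℝ →ₘ[μ] ℝ :=
  AEEqFun.mk (fun x => (cesaroAvg f x).toReal)
    (measurable_cesaroAvg f).ennreal_toReal.aestronglyMeasurable

theorem cesaroAvg_add_le {μ : Measure ℝ} (f g : ℝ →ₘ[μ] ℝ) (x : ℝ) :
    cesaroAvg (f + g) x ≤ cesaroAvg f x + cesaroAvg g x := by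
  unfold cesaroAvg
  rw [← ENNReal.add_div]
  refine ENNReal.div_le_div_right ?_ _
  rw [← lintegral_add_left' (f.aestronglyMeasurable.restrict.enorm)]
  refine lintegral_mono_ae (ae_restrict_of_ae ?_)
  filter_upwards [AEEqFun.coeFn_add f g] with t ht
  rw [ht]
  exact enorm_add_le _ _

theorem cesaroAvg_smul {μ : Measure ℝ} (c : ℝ) (f : ℝ →ₘ[μ] ℝ) (x : ℝ) :
    cesaroAvg (c • f) x = ‖c‖ₑ * cesaroAvg f x := by
  unfold cesaroAvg
  rw [← mul_div_assoc, ← lintegral_const_mul' _ _ enorm_ne_top]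
  congr 1
  refine lintegral_congr_ae (ae_restrict_of_ae ?_)
  filter_upwards [AEEqFun.coeFn_smul c f] with t ht
  rw [ht, Pi.smul_apply, enorm_smul]

theorem cesaroAvg_zero {μ : Measure ℝ} (x : ℝ) : cesaroAvg (0 : ℝ →ₘ[μ] ℝ) x = 0 := by
  have h := cesaroAvg_smul (0 : ℝ) (0 : ℝ →ₘ[μ] ℝ) x
  simpa using h

/-- The abstract Cesàro space `CX = {f ∈ L₀ : C(|f|) ∈ X}`. -/
noncomputable def cesaroSpace {μ : Measure ℝ} (X : BanachIdealSpace μ) :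
    Submodule ℝ (ℝ →ₘ[μ] ℝ) where
  carrier := {f | (∀ᵐ x ∂μ, cesaroAvg f x ≠ ∞) ∧ cesaro f ∈ X.carrier}
  zero_mem' := by
    refine ⟨by simp [cesaroAvg_zero], ?_⟩
    have h : cesaro (0 : ℝ →ₘ[μ] ℝ) = 0 := by
      refine AEEqFun.ext ((AEEqFun.coeFn_mk _ _).trans ?_)
      filter_upwards [AEEqFun.coeFn_zero (μ := μ) (α := ℝ) (β := ℝ)] with t ht
      rw [ht, cesaroAvg_zero]
      rfl
    rw [h]
    exact X.carrier.zero_mem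
  add_mem' := by
    rintro f g ⟨hf, hf'⟩ ⟨hg, hg'⟩
    refine ⟨?_, ?_⟩
    · filter_upwards [hf, hg] with x h1 h2
      exact ne_top_of_le_ne_top (ENNReal.add_ne_top.2 ⟨h1, h2⟩) (cesaroAvg_add_le f g x)
    · refine (X.ideal _ ⟨_, X.carrier.add_mem hf' hg'⟩ ?_).1
      rw [← AEEqFun.coeFn_le]
      filter_upwards [hf, hg, AEEqFun.coeFn_abs (cesaro (f + g)),
        AEEqFun.coeFn_abs (cesaro f + cesaro g), AEEqFun.coeFn_add (cesaro f) (cesaro g),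
        AEEqFun.coeFn_mk (fun x => (cesaroAvg f x).toReal)
          (measurable_cesaroAvg f).ennreal_toReal.aestronglyMeasurable,
        AEEqFun.coeFn_mk (fun x => (cesaroAvg g x).toReal)
          (measurable_cesaroAvg g).ennreal_toReal.aestronglyMeasurable,
        AEEqFun.coeFn_mk (fun x => (cesaroAvg (f + g) x).toReal)
          (measurable_cesaroAvg (f + g)).ennreal_toReal.aestronglyMeasurable]
        with x h1 h2 h3 h4 h5 h6 h7 h8
      rw [h3, h4, h5, Pi.add_apply]
      unfold cesaro
      rw [h6, h7, h8, ← ENNReal.toReal_add h1 h2, abs_of_nonneg ENNReal.toReal_nonneg,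
        abs_of_nonneg ENNReal.toReal_nonneg]
      exact ENNReal.toReal_mono (ENNReal.add_ne_top.2 ⟨h1, h2⟩) (cesaroAvg_add_le f g x)
  smul_mem' := by
    rintro c f ⟨hf, hf'⟩
    refine ⟨?_, ?_⟩
    · filter_upwards [hf] with x h1
      rw [cesaroAvg_smul]
      exact ENNReal.mul_ne_top enorm_ne_top h1
    · have h : cesaro (c • f) = |c| • cesaro f := by
        refine AEEqFun.ext ((AEEqFun.coeFn_mk _ _).trans ?_)
        filter_upwards [AEEqFun.coeFn_smul |c| (cesaro f),
          AEEqFun.coeFn_mk (fun x => (cesaroAvg f x).toReal)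
            (measurable_cesaroAvg f).ennreal_toReal.aestronglyMeasurable] with x h1 h2
        rw [h1, Pi.smul_apply]
        unfold cesaro
        rw [h2, cesaroAvg_smul, ENNReal.toReal_mul, smul_eq_mul, toReal_enorm, Real.norm_eq_abs]
      rw [h]
      exact X.carrier.smul_mem _ hf'

/-- The norm `‖f‖_{CX} = ‖C(|f|)‖_X` of the Cesàro space. -/
noncomputable def cesaroNorm {μ : Measure ℝ} (X : BanachIdealSpace μ) (f : cesaroSpace X) : ℝ :=
  X.nrm ⟨cesaro (f : ℝ →ₘ[μ] ℝ), f.2.2⟩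

/-- A linear space `E ⊆ L₀(μ)` of functions with norm `N` contains a lattice isometric copy of
`ℓ_∞`: there is a linear isometry of `ℓ_∞` into `E` preserving the lattice operations (suprema,
hence also infima and moduli; those of `ℓ_∞` are coordinatewise). -/
def ContainsLatticeIsometricLinfty {α : Type*} [MeasurableSpace α] {μ : Measure α}
    (E : Submodule ℝ (α →ₘ[μ] ℝ)) (N : E → ℝ) : Prop :=
  ∃ T : lp (fun _ : ℕ => ℝ) ∞ →ₗ[ℝ] E,
    (∀ x, N (T x) = ‖x‖) ∧
    ∀ x y z : lp (fun _ : ℕ => ℝ) ∞, (∀ n, z n = x n ⊔ y n) →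
      (T z : α →ₘ[μ] ℝ) = (T x : α →ₘ[μ] ℝ) ⊔ (T y : α →ₘ[μ] ℝ)

/-!
Since `‖id : X → L_∞‖` is finite, every `g ∈ CX` satisfies `‖C(g)‖_∞ ≤ ‖id‖ ‖g‖_{CX}`, so functions
whose averages come close to `1` near the origin have norm at least `1 / ‖id‖ = ‖f‖_{CX}`.

The proof partitions the line into sets `Aₙ`, `n ∈ ℕ`, such that the averages of each piece
`f 1_{Aₙ}` still have upper limit `1` at `0`. With `x_k = exp (-k²)` one has `x_{k+1} / x_k → 0`, so
the part of `f` on the block `[x_{k+1}, x_k)` alone has average at `x_k` tending to `1` as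
`k → ∞`. It thus suffices that each `Aₙ` contains infinitely many blocks, which is arranged by the
pairing function of `ℕ` (`blockIndex`).

The map `T x = ‖f‖⁻¹ ∑ₙ xₙ f 1_{Aₙ}` is then the required isometry: `|T x| ≤ ‖f‖⁻¹ ‖x‖_∞ f` and
the ideal property of `X` give `‖T x‖ ≤ ‖x‖_∞` (`exists_cesaroNorm_le`), whereas
`|T x| ≥ ‖f‖⁻¹ |xₙ| f 1_{Aₙ}` gives `‖T x‖ ≥ |xₙ|` for all `n` (`le_of_forall_cesaroAvg_le`).
-/

/-! ### Norm estimates in `X` and `CX` -/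

theorem BanachIdealSpace.eLpNorm_top_le {α : Type*} [MeasurableSpace α] {μ : Measure α}
    (X : BanachIdealSpace μ) (g : X.carrier) :
    eLpNorm (g : α →ₘ[μ] ℝ) ∞ μ ≤ X.normIdLinfty * ENNReal.ofReal (X.nrm g) := by
  rcases (apply_nonneg X.nrm g).eq_or_lt with h0 | h0
  · rw [X.eq_zero_of_nrm g h0.symm, ZeroMemClass.coe_zero,
      eLpNorm_congr_ae AEEqFun.coeFn_zero, eLpNorm_zero]
    exact zero_le
  · have h1 : X.nrm ((X.nrm g)⁻¹ • g) ≤ 1 := by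
      rw [map_smul_eq_mul, norm_inv, Real.norm_of_nonneg h0.le, inv_mul_cancel₀ h0.ne']
    have h2 : eLpNorm (((X.nrm g)⁻¹ • g : X.carrier) : α →ₘ[μ] ℝ) ∞ μ ≤ X.normIdLinfty :=
      le_iSup₂ (f := fun (g : X.carrier) (_ : X.nrm g ≤ 1) =>
        eLpNorm (g : α →ₘ[μ] ℝ) ∞ μ) _ h1
    rw [Submodule.coe_smul, eLpNorm_congr_ae (AEEqFun.coeFn_smul _ _), eLpNorm_const_smul,
      enorm_inv h0.ne', Real.enorm_eq_ofReal h0.le] at h2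
    rwa [mul_comm, ← div_eq_mul_inv,
      ENNReal.div_le_iff (ENNReal.ofReal_pos.2 h0).ne' ENNReal.ofReal_ne_top] at h2

theorem coeFn_cesaro {μ : Measure ℝ} (f : ℝ →ₘ[μ] ℝ) :
    cesaro f =ᵐ[μ] fun x => (cesaroAvg f x).toReal :=
  AEEqFun.coeFn_mk _ _

/-- `CX` inherits the ideal property of `X`. -/
theorem exists_cesaroNorm_le {μ : Measure ℝ} {X : BanachIdealSpace μ} (f : cesaroSpace X)
    (g : ℝ →ₘ[μ] ℝ) {c : ℝ} (hc : 0 ≤ c)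
    (h : ∀ᵐ t ∂μ, ‖g t‖ ≤ c * ‖(f : ℝ →ₘ[μ] ℝ) t‖) :
    ∃ hg : g ∈ cesaroSpace X, cesaroNorm X ⟨g, hg⟩ ≤ c * cesaroNorm X f := by
  have hle : ∀ x, cesaroAvg g x ≤ ENNReal.ofReal c * cesaroAvg (f : ℝ →ₘ[μ] ℝ) x := by
    intro x
    rw [← Real.enorm_eq_ofReal hc, ← cesaroAvg_smul]
    refine ENNReal.div_le_div_right (lintegral_mono_ae (ae_restrict_of_ae ?_)) _
    filter_upwards [h, AEEqFun.coeFn_smul c (f : ℝ →ₘ[μ] ℝ)] with t ht hs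
    rw [hs, Pi.smul_apply, enorm_le_iff_norm_le, norm_smul, Real.norm_of_nonneg hc]
    exact ht
  have hfin : ∀ᵐ x ∂μ, cesaroAvg g x ≠ ∞ := by
    filter_upwards [f.2.1] with x hx
    exact ne_top_of_le_ne_top (ENNReal.mul_ne_top ENNReal.ofReal_ne_top hx) (hle x)
  obtain ⟨hm, hn⟩ := X.ideal (cesaro g) (c • ⟨cesaro (f : ℝ →ₘ[μ] ℝ), f.2.2⟩) (by
    rw [← AEEqFun.coeFn_le]
    filter_upwards [f.2.1, AEEqFun.coeFn_abs (cesaro g), coeFn_cesaro g,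
      coeFn_cesaro (f : ℝ →ₘ[μ] ℝ), AEEqFun.coeFn_smul c (cesaro (f : ℝ →ₘ[μ] ℝ)),
      AEEqFun.coeFn_abs (c • cesaro (f : ℝ →ₘ[μ] ℝ))] with x hx h1 h2 h3 h4 h5
    rw [h1, h2, Submodule.coe_smul, h5, h4, Pi.smul_apply, h3, smul_eq_mul,
      abs_of_nonneg ENNReal.toReal_nonneg, abs_of_nonneg (mul_nonneg hc ENNReal.toReal_nonneg)]
    refine (ENNReal.toReal_mono (ENNReal.mul_ne_top ENNReal.ofReal_ne_top hx) (hle x)).trans_eq ?_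
    rw [ENNReal.toReal_mul, ENNReal.toReal_ofReal hc])
  refine ⟨⟨hfin, hm⟩, hn.trans_eq ?_⟩
  rw [map_smul_eq_mul, Real.norm_of_nonneg hc]
  rfl

/-- An almost everywhere bound for the averages holds everywhere, because `x ↦ x C(g)(x)` is
monotone: the average at `x` is at most `y / x` times the average at any `y > x`. -/
theorem cesaroAvg_le_of_ae_le {Ω : Set ℝ} (hΩ : Ioo 0 1 ⊆ Ω)
    (g : ℝ →ₘ[volume.restrict Ω] ℝ) {M : ℝ≥0∞}
    (h : ∀ᵐ x ∂(volume.restrict Ω), cesaroAvg g x ≤ M) {x : ℝ} (hx : x ∈ Ioo 0 1) :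
    cesaroAvg g x ≤ M := by
  have h1 : ∀ᵐ y ∂(volume.restrict (Ioo (0 : ℝ) 1)), cesaroAvg g y ≤ M :=
    ae_mono (Measure.restrict_mono_set _ hΩ) h
  have h2 : ∀ᵐ y, y ∈ Ioo (0 : ℝ) 1 → cesaroAvg g y ≤ M :=
    (ae_restrict_iff' measurableSet_Ioo).1 h1
  -- the bound holds at points of `(x, 1)` arbitrarily close to `x`
  have hfreq : ∃ᶠ y in 𝓝[>] x, cesaroAvg g y ≤ M ∧ x < y := by
    refine (Filter.Frequently.and_eventually ?_ self_mem_nhdsWithin)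
    intro hev
    have hev' : ∀ᶠ y in 𝓝[>] x, ¬ cesaroAvg g y ≤ M ∧ y ∈ Ioo (0 : ℝ) 1 :=
      hev.and (nhdsWithin_le_nhds (isOpen_Ioo.mem_nhds hx))
    obtain ⟨u, hu, hsub⟩ := mem_nhdsGT_iff_exists_Ioo_subset.1 hev'
    have hnull : volume (Ioo x u) = 0 :=
      measure_mono_null (fun y hy => by
        simp only [mem_compl_iff, mem_ofPred_eq, Classical.not_imp]
        exact ⟨(hsub hy).2, (hsub hy).1⟩) h2
    rw [Real.volume_Ioo, ENNReal.ofReal_eq_zero] at hnull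
    linarith [mem_Ioi.1 hu]
  have hx0 : ENNReal.ofReal x ≠ 0 := (ENNReal.ofReal_pos.2 hx.1).ne'
  have hlim : Tendsto (fun y => M * ENNReal.ofReal y) (𝓝[>] x) (𝓝 (M * ENNReal.ofReal x)) :=
    ENNReal.Tendsto.const_mul
      ((ENNReal.continuous_ofReal.tendsto x).mono_left nhdsWithin_le_nhds) (Or.inl hx0)
  unfold cesaroAvg
  rw [ENNReal.div_le_iff hx0 ENNReal.ofReal_ne_top]
  refine ge_of_tendsto_of_frequently hlim (hfreq.mono ?_)
  rintro y ⟨hy, hxy⟩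
  have hy0 : ENNReal.ofReal y ≠ 0 := (ENNReal.ofReal_pos.2 (hx.1.trans hxy)).ne'
  exact (lintegral_mono_set (Ioo_subset_Ioo_right hxy.le)).trans
    ((ENNReal.div_le_iff hy0 ENNReal.ofReal_ne_top).1 hy)

/-! ### Splitting the line into sets with infinitely many blocks near the origin -/

/-- The index `n` of the set `Aₙ` containing `t`: on the block `exp (-(k+1)²) ≤ t < exp (-k²)` it is
the first component of `k` under the pairing `ℕ ≃ ℕ × ℕ`, so that every `n` is taken on infinitely
many blocks accumulating at `0`. The values off `(0, 1)` are irrelevant. -/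
noncomputable def blockIndex (t : ℝ) : ℕ :=
  (Nat.unpair (⌈√(-Real.log t)⌉₊ - 1)).1

theorem measurable_blockIndex : Measurable blockIndex :=
  (measurable_from_top (f := fun k : ℕ => (Nat.unpair (k - 1)).1)).comp
    (Nat.measurable_ceil.comp Real.measurable_log.neg.sqrt)

theorem blockIndex_eq {n j : ℕ} {t : ℝ} (h1 : Real.exp (-((Nat.pair n j : ℝ) + 1) ^ 2) ≤ t)
    (h2 : t < Real.exp (-(Nat.pair n j : ℝ) ^ 2)) : blockIndex t = n := by
  have ht : 0 < t := (Real.exp_pos _).trans_le h1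
  have h1' := (Real.le_log_iff_exp_le ht).2 h1
  have h2' := (Real.log_lt_iff_lt_exp ht).2 h2
  have hk : ⌈√(-Real.log t)⌉₊ = Nat.pair n j + 1 := by
    rw [Nat.ceil_eq_iff (Nat.succ_ne_zero _), Nat.succ_sub_one]
    refine ⟨Real.lt_sqrt_of_sq_lt (by linarith), ?_⟩
    rw [Real.sqrt_le_left (by positivity)]
    push_cast
    linarith
  rw [blockIndex, hk, Nat.add_sub_cancel, Nat.unpair_pair]

/-- If `C(f)(0⁺) = 1` and `|g| ≥ a |f|` on the `n`-th set, then `a` is at most every bound for the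
averages of `g`. -/
theorem le_of_forall_cesaroAvg_le {μ : Measure ℝ} {f g : ℝ →ₘ[μ] ℝ}
    (hf0 : Tendsto (cesaroAvg f) (𝓝[>] 0) (𝓝 1)) {a M : ℝ≥0∞} (ha : a ≠ ∞) (n : ℕ)
    (h : ∀ᵐ t ∂μ, blockIndex t = n → a * ‖f t‖ₑ ≤ ‖g t‖ₑ)
    (hM : ∀ x ∈ Ioo (0 : ℝ) 1, cesaroAvg g x ≤ M) : a ≤ M := by
  have hk : Tendsto (fun j => (Nat.pair n j : ℝ)) atTop atTop :=
    tendsto_natCast_atTop_atTop.comp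
      (tendsto_atTop_mono (fun j => Nat.right_le_pair n j) tendsto_id)
  have hx : Tendsto (fun y : ℝ => Real.exp (-y ^ 2)) atTop (𝓝[>] 0) :=
    tendsto_nhdsWithin_iff.2 ⟨Real.tendsto_exp_neg_atTop_nhds_zero.comp
      (tendsto_pow_atTop two_ne_zero), Eventually.of_forall fun _ => Real.exp_pos _⟩
  have hC0 := hf0.comp (hx.comp hk)
  have hC1 := hf0.comp (hx.comp (tendsto_atTop_add_const_right _ 1 hk))
  have hr : Tendsto (fun j => ENNReal.ofReal (Real.exp (-(2 * (Nat.pair n j : ℝ) + 1))))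
      atTop (𝓝 0) := by
    rw [← ENNReal.ofReal_zero]
    exact (ENNReal.continuous_ofReal.tendsto 0).comp (Real.tendsto_exp_neg_atTop_nhds_zero.comp
      (tendsto_atTop_add_const_right _ 1 (hk.const_mul_atTop two_pos)))
  have hL := ENNReal.Tendsto.const_mul (a := a) hC0 (Or.inr ha)
  have hR := (ENNReal.Tendsto.const_mul (a := a)
    (ENNReal.Tendsto.mul hC1 (Or.inl one_ne_zero) hr (Or.inr ENNReal.one_ne_top))
      (Or.inr ha)).add_const M
  -- `a C(f)(x_k) ≤ a (x_{k+1} / x_k) C(f)(x_{k+1}) + M` along `k = pair n j`, and `j → ∞`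
  rw [mul_one] at hL
  rw [mul_zero, mul_zero, zero_add] at hR
  refine le_of_tendsto_of_tendsto hL hR ?_
  filter_upwards [hk.eventually_gt_atTop 0] with j hj
  simp only [Function.comp_apply]
  have hq : Real.exp (-((Nat.pair n j : ℝ) + 1) ^ 2)
      = Real.exp (-(2 * (Nat.pair n j : ℝ) + 1)) * Real.exp (-(Nat.pair n j : ℝ) ^ 2) := by
    rw [← Real.exp_add]
    ring_nf
  have hb1 : Real.exp (-(Nat.pair n j : ℝ) ^ 2) < 1 :=
    Real.exp_lt_one_iff.2 (neg_lt_zero.2 (by positivity))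
  have hidx : ∀ t, Real.exp (-((Nat.pair n j : ℝ) + 1) ^ 2) ≤ t →
      t < Real.exp (-(Nat.pair n j : ℝ) ^ 2) → blockIndex t = n := fun t => blockIndex_eq
  have hpos := Real.exp_pos (-(Nat.pair n j : ℝ) ^ 2)
  have hrpos := Real.exp_pos (-(2 * (Nat.pair n j : ℝ) + 1))
  -- From here on only these properties of the block `[b', b)`, with `b' = r * b`, matter.
  generalize Real.exp (-(Nat.pair n j : ℝ) ^ 2) = b at *
  generalize Real.exp (-((Nat.pair n j : ℝ) + 1) ^ 2) = b' at *
  generalize Real.exp (-(2 * (Nat.pair n j : ℝ) + 1)) = r at *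
  have hint : a * ∫⁻ t in Ioo 0 b, ‖f t‖ₑ ∂μ
      ≤ a * ∫⁻ t in Ioo 0 b', ‖f t‖ₑ ∂μ + ∫⁻ t in Ioo 0 b, ‖g t‖ₑ ∂μ := by
    have hsub : Ioo 0 b ⊆ Ioo 0 b' ∪ (Ioo 0 b ∩ Ici b') := fun t ht =>
      (lt_or_ge t b').imp (fun h' => ⟨ht.1, h'⟩) (fun h' => ⟨ht, h'⟩)
    calc a * ∫⁻ t in Ioo 0 b, ‖f t‖ₑ ∂μ
        ≤ a * (∫⁻ t in Ioo 0 b', ‖f t‖ₑ ∂μ + ∫⁻ t in Ioo 0 b ∩ Ici b', ‖f t‖ₑ ∂μ) :=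
          mul_le_mul_right ((lintegral_mono_set hsub).trans (lintegral_union_le _ _ _)) _
      _ = a * ∫⁻ t in Ioo 0 b', ‖f t‖ₑ ∂μ + ∫⁻ t in Ioo 0 b ∩ Ici b', a * ‖f t‖ₑ ∂μ := by
          rw [mul_add, lintegral_const_mul' _ _ ha]
      _ ≤ _ := by
          refine add_le_add le_rfl (le_trans ?_
            (lintegral_mono_set (inter_subset_left (t := Ici b'))))
          refine lintegral_mono_ae ?_
          filter_upwards [ae_restrict_of_ae h,
            ae_restrict_mem (measurableSet_Ioo.inter measurableSet_Ici)] with t ht htm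
          exact ht (hidx t htm.2 htm.1.2)
  have hdiv := ENNReal.div_le_div_right hint (ENNReal.ofReal b)
  rw [ENNReal.add_div, mul_div_assoc, mul_div_assoc] at hdiv
  refine hdiv.trans (add_le_add (le_of_eq ?_) (hM b ⟨hpos, hb1⟩))
  congr 1
  have hr0 : ENNReal.ofReal r ≠ 0 := (ENNReal.ofReal_pos.2 hrpos).ne'
  rw [cesaroAvg, hq, ENNReal.ofReal_mul hrpos.le, div_eq_mul_inv, div_eq_mul_inv,
    ENNReal.mul_inv (Or.inl hr0) (Or.inl ENNReal.ofReal_ne_top), mul_assoc, mul_right_comm,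
    ENNReal.inv_mul_cancel hr0 ENNReal.ofReal_ne_top, one_mul]

/-! ### The embedding of `ℓ_∞` -/

/-- The function `t ↦ c x_{n(t)} f(t)`, where `n(t)` is the index of the set containing `t`. -/
noncomputable def blockMul {μ : Measure ℝ} (c : ℝ) (f : ℝ →ₘ[μ] ℝ) (x : ℕ → ℝ) : ℝ →ₘ[μ] ℝ :=
  AEEqFun.mk (fun t => c * (x (blockIndex t) * f t))
    (((measurable_from_top.comp measurable_blockIndex).aestronglyMeasurable.mul
      f.aestronglyMeasurable).const_mul c)

theorem coeFn_blockMul {μ : Measure ℝ} (c : ℝ) (f : ℝ →ₘ[μ] ℝ) (x : ℕ → ℝ) :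
    blockMul c f x =ᵐ[μ] fun t => c * (x (blockIndex t) * f t) :=
  AEEqFun.coeFn_mk _ _

theorem mainTheorem3 (Ω : Set ℝ) (hΩ : Ω = Ioo 0 1 ∨ Ω = Ioi 0)
    (X : BanachIdealSpace (volume.restrict Ω))
    (hri : X.IsRearrangementInvariant) (hFatou : X.HasFatouProperty)
    (hXa : X.orderContinuousPart = {0})
    (f : cesaroSpace X) (hf : 0 < (f : ℝ →ₘ[volume.restrict Ω] ℝ))
    (hf0 : Tendsto (cesaroAvg (f : ℝ →ₘ[volume.restrict Ω] ℝ)) (𝓝[>] 0) (𝓝 1))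
    (hnorm : ENNReal.ofReal (cesaroNorm X f) * X.normIdLinfty = 1) :
    ContainsLatticeIsometricLinfty (cesaroSpace X) (cesaroNorm X) := by
  have hsub : Ioo (0 : ℝ) 1 ⊆ Ω := by
    rcases hΩ with rfl | rfl
    exacts [Subset.rfl, fun t ht => ht.1]
  have hN : 0 < cesaroNorm X f := by
    by_contra! hle
    rw [ENNReal.ofReal_of_nonpos hle, zero_mul] at hnorm
    exact zero_ne_one hnorm
  -- In particular `‖id : X → L_∞‖` is finite, as `0 * ∞ = 0 ≠ 1` and `r * ∞ = ∞ ≠ 1` for `r > 0`.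
  have hK : X.normIdLinfty = ENNReal.ofReal (cesaroNorm X f)⁻¹ := by
    rw [ENNReal.ofReal_inv_of_pos hN]
    exact ENNReal.eq_inv_of_mul_eq_one_left (by rwa [mul_comm])
  set c : ℝ := (cesaroNorm X f)⁻¹ with hc
  have hc0 : 0 < c := inv_pos.2 hN
  have hbound : ∀ x : lp (fun _ : ℕ => ℝ) ∞, ∀ᵐ t ∂(volume.restrict Ω),
      ‖blockMul c (f : ℝ →ₘ[volume.restrict Ω] ℝ) x t‖
        ≤ c * ‖x‖ * ‖(f : ℝ →ₘ[volume.restrict Ω] ℝ) t‖ := by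
    intro x
    filter_upwards [coeFn_blockMul c (f : ℝ →ₘ[volume.restrict Ω] ℝ) x] with t ht
    rw [ht, norm_mul, norm_mul, Real.norm_of_nonneg hc0.le, mul_assoc]
    gcongr
    exact lp.norm_apply_le_norm ENNReal.top_ne_zero x _
  have hT := fun x : lp (fun _ : ℕ => ℝ) ∞ =>
    exists_cesaroNorm_le f _ (mul_nonneg hc0.le (norm_nonneg x)) (hbound x)
  refine ⟨{ toFun := fun x => ⟨blockMul c (f : ℝ →ₘ[volume.restrict Ω] ℝ) x, (hT x).1⟩
            map_add' := ?_
            map_smul' := ?_ }, ?_, ?_⟩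
  · intro x y
    refine Subtype.ext (AEEqFun.ext ?_)
    filter_upwards [coeFn_blockMul c (f : ℝ →ₘ[volume.restrict Ω] ℝ) x,
      coeFn_blockMul c (f : ℝ →ₘ[volume.restrict Ω] ℝ) y,
      coeFn_blockMul c (f : ℝ →ₘ[volume.restrict Ω] ℝ) (x + y : lp (fun _ : ℕ => ℝ) ∞),
      AEEqFun.coeFn_add (blockMul c (f : ℝ →ₘ[volume.restrict Ω] ℝ) x)
        (blockMul c (f : ℝ →ₘ[volume.restrict Ω] ℝ) y)] with t h1 h2 h3 h4
    rw [Submodule.coe_add, h4, Pi.add_apply, h1, h2, h3, lp.coeFn_add, Pi.add_apply]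
    ring
  · intro s x
    refine Subtype.ext (AEEqFun.ext ?_)
    filter_upwards [coeFn_blockMul c (f : ℝ →ₘ[volume.restrict Ω] ℝ) x,
      coeFn_blockMul c (f : ℝ →ₘ[volume.restrict Ω] ℝ) (s • x : lp (fun _ : ℕ => ℝ) ∞),
      AEEqFun.coeFn_smul s (blockMul c (f : ℝ →ₘ[volume.restrict Ω] ℝ) x)] with t h1 h2 h3
    rw [RingHom.id_apply, Submodule.coe_smul, h3, Pi.smul_apply, h1, h2, lp.coeFn_smul,
      Pi.smul_apply, smul_eq_mul, smul_eq_mul]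
    ring
  · intro x
    obtain ⟨hm, hle⟩ := hT x
    refine le_antisymm (hle.trans_eq ?_) (lp.norm_le_of_forall_le (apply_nonneg X.nrm _) ?_)
    · rw [mul_right_comm, hc, inv_mul_cancel₀ hN.ne', one_mul]
    intro n
    have hsup := X.eLpNorm_top_le ⟨cesaro (blockMul c (f : ℝ →ₘ[volume.restrict Ω] ℝ) x), hm.2⟩
    have hae : ∀ᵐ y ∂(volume.restrict Ω),
        cesaroAvg (blockMul c (f : ℝ →ₘ[volume.restrict Ω] ℝ) x) y
          ≤ ENNReal.ofReal (c * cesaroNorm X ⟨_, hm⟩) := by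
      rw [hK, ← ENNReal.ofReal_mul hc0.le, eLpNorm_exponent_top] at hsup
      filter_upwards [hm.1, coeFn_cesaro (blockMul c (f : ℝ →ₘ[volume.restrict Ω] ℝ) x),
        enorm_ae_le_eLpNormEssSup (cesaro (blockMul c (f : ℝ →ₘ[volume.restrict Ω] ℝ) x))
          (volume.restrict Ω)] with y h1 h2 h3
      rw [h2, Real.enorm_eq_ofReal ENNReal.toReal_nonneg, ENNReal.ofReal_toReal h1] at h3
      exact h3.trans hsup
    have hn := le_of_forall_cesaroAvg_le hf0 (a := ENNReal.ofReal (c * ‖x n‖))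
      ENNReal.ofReal_ne_top n (by
        filter_upwards [coeFn_blockMul c (f : ℝ →ₘ[volume.restrict Ω] ℝ) x] with t ht hidx
        rw [ht, hidx, enorm_mul, enorm_mul, ENNReal.ofReal_mul hc0.le, ofReal_norm,
          Real.enorm_eq_ofReal hc0.le, mul_assoc])
      (fun y hy => cesaroAvg_le_of_ae_le hsub _ hae hy)
    exact le_of_mul_le_mul_left
      ((ENNReal.ofReal_le_ofReal_iff (mul_nonneg hc0.le (apply_nonneg X.nrm _))).1 hn) hc0
  · intro x y z hz
    refine AEEqFun.ext ?_
    filter_upwards [coeFn_blockMul c (f : ℝ →ₘ[volume.restrict Ω] ℝ) x,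
      coeFn_blockMul c (f : ℝ →ₘ[volume.restrict Ω] ℝ) y,
      coeFn_blockMul c (f : ℝ →ₘ[volume.restrict Ω] ℝ) z,
      AEEqFun.coeFn_sup (blockMul c (f : ℝ →ₘ[volume.restrict Ω] ℝ) x)
        (blockMul c (f : ℝ →ₘ[volume.restrict Ω] ℝ) y),
      AEEqFun.coeFn_le.2 hf.le, AEEqFun.coeFn_zero (μ := volume.restrict Ω) (α := ℝ) (β := ℝ)]
      with t h1 h2 h3 h4 h5 h6
    rw [h6] at h5
    simp only [LinearMap.coe_mk, AddHom.coe_mk]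
    rw [h4, h1, h2, h3, hz, ← mul_max_of_nonneg _ _ hc0.le, ← max_mul_of_nonneg _ _ h5]
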